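/- Let $E$ be a complex Banach space that contains no isomorphic copy of $c_0$ (no linear subspace of $E$ is linearly homeomorphic to $c_0$). Let $\mathcal S\subseteq\mathscr L(E)$ be a bounded abelian operator semigroup, that is, a nonempty, norm-bounded set of pairwise commuting bounded linear operators which is closed under composition. For $x\in E$ write $\mathcal S x=\{Sx\mid S\in\mathcal S\}$, and let $$E_{\mathrm{aap}}=\{x\in E\mid \mathcal S x\text{ is relatively compact}\},$$ a closed $\mathcal S$-invariant linear subspace. Let $\overline{\mathcal S|_{E_{\mathrm{aap}}}}$ be the closure of $\{S|_{E_{\mathrm{aap}}}\mid S\in\mathcal S\}$ in $\mathscr L(E_{\mathrm{aap}})$ with respect to the strong operator topology. Then there is a unique projection $P\in\overline{\mathcal S|_{E_{\mathrm{aap}}}}$ (the Jacobs--de Leeuw--Glicksberg projection) such that $\operatorname{rg}P$ and $\ker P$ are invariant under $\overline{\mathcal S|_{E_{\mathrm{aap}}}}$, the restriction of $\overline{\mathcal S|_{E_{\mathrm{aap}}}}$ to $\operatorname{rg}P$ is a compact topological group for composition and the strong operator topology, with the identity operator as neutral element, and the restriction of $\overline{\mathcal S|_{E_{\mathrm{aap}}}}$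 to $\ker P$ contains the zero operator. With this $P$, for every $x\in E$ the following assertions are equivalent: (a) $\mathcal S x$ is relatively compact. (b) The following two conditions are satisfied: (i) $\mathcal S(I-T)x=\{Sx-STx\mid S\in\mathcal S\}$ is relatively compact for every $T\in\mathcal S$ (that is, $(I-T)x\in E_{\mathrm{aap}}$ for every $T\in\mathcal S$); (ii) $(I-P)(I-\mathcal S)x=\{(I-P)(x-Tx)\mid T\in\mathcal S\}$ is relatively compact. -/

import Mathlib

open Topology
open scoped ZeroAtInfty

namespace JdLG

/-- `E` contains an isomorphic copy of `c₀`: some linear subspace of `E` is linearly homeomorphic to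
the Banach space `C₀(ℕ, ℂ)` of complex null sequences with the supremum norm. (Such a subspace is
automatically closed.) -/
def ContainsCZero (E : Type*) [NormedAddCommGroup E] [NormedSpace ℂ E] : Prop :=
  ∃ V : Submodule ℂ E, Nonempty (C₀(ℕ, ℂ) ≃L[ℂ] V)

/-- A subset of a space is relatively compact if its closure is compact. -/
def RelCompact {X : Type*} [TopologicalSpace X] (A : Set X) : Prop := IsCompact (closure A)

theorem RelCompact.mono {X : Type*} [TopologicalSpace X] {A B : Set X} (hB : RelCompact B) (h : A ⊆ B) : RelCompact A :=
  IsCompact.of_isClosed_subset hB isClosed_closure (closure_mono h)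

theorem relCompact_of_subset {X : Type*} [TopologicalSpace X] [T2Space X] {A K : Set X} (hK : IsCompact K) (h : A ⊆ K) : RelCompact A :=
  IsCompact.of_isClosed_subset hK isClosed_closure (closure_minimal h hK.isClosed)

section Operators

variable {F : Type*} [NormedAddCommGroup F] [NormedSpace ℂ F]

/-- The orbit `𝒮 x = {T x | T ∈ 𝒮}`. -/
def orbit (S : Set (F →L[ℂ] F)) (x : F) : Set F := {y | ∃ T ∈ S, y = T x}

/-- `F_aap`: the linear subspace of all vectors with relatively compact orbit. -/
def aap (S : Set (F →L[ℂ] F)) : Submodule ℂ F where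
  carrier := {x | RelCompact (orbit S x)}
  zero_mem' := by
    refine relCompact_of_subset (isCompact_singleton (x := (0 : F))) ?_
    rintro y ⟨T, -, rfl⟩
    simp
  add_mem' := by
    intro a b ha hb
    refine relCompact_of_subset (IsCompact.add ha hb) ?_
    rintro y ⟨T, hT, rfl⟩
    rw [map_add]
    exact Set.add_mem_add (subset_closure ⟨T, hT, rfl⟩) (subset_closure ⟨T, hT, rfl⟩)
  smul_mem' := by
    intro c a ha
    refine relCompact_of_subset (IsCompact.image ha (continuous_const_smul c)) ?_
    rintro y ⟨T, hT, rfl⟩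
    exact ⟨T a, subset_closure ⟨T, hT, rfl⟩, (map_smul T c a).symm⟩

theorem mem_aap {S : Set (F →L[ℂ] F)} {x : F} : x ∈ aap S ↔ RelCompact (orbit S x) := Iff.rfl

/-- `F_aap` is invariant under the semigroup, so that the semigroup can be restricted to it. -/
theorem mapsTo_aap (S : Subsemigroup (F →L[ℂ] F)) {T : F →L[ℂ] F} (hT : T ∈ S) {x : F}
    (hx : x ∈ aap (S : Set (F →L[ℂ] F))) : T x ∈ aap (S : Set (F →L[ℂ] F)) := by
  refine RelCompact.mono (mem_aap.1 hx) ?_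
  rintro y ⟨R, hR, rfl⟩
  exact ⟨R * T, S.mul_mem hR hT, rfl⟩

/-- The set `{T|_V | T ∈ 𝒜}` of restrictions to a linear subspace `V` (to be used for subspaces
that are invariant under every `T ∈ 𝒜`). -/
def restrictOps (A : Set (F →L[ℂ] F)) (V : Submodule ℂ F) : Set (V →L[ℂ] V) :=
  {B | ∃ T ∈ A, ∀ v : V, (B v : F) = T v}

variable (F) in
/-- The strong operator topology on `ℒ(F)`, that is, the topology of pointwise convergence. -/
@[reducible] def sot : TopologicalSpace (F →L[ℂ] F) :=
  TopologicalSpace.induced (fun T : F →L[ℂ] F => (T : F → F)) Pi.topologicalSpace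

/-- The closure in the strong operator topology. -/
def sotClosure (A : Set (F →L[ℂ] F)) : Set (F →L[ℂ] F) := closure[sot F] A

/-- A set of operators on `F` that, with composition as multiplication, the identity operator as
neutral element, and the strong operator topology, is a compact topological group. -/
structure IsCompactTopGroup (G : Set (F →L[ℂ] F)) : Prop where
  one_mem : 1 ∈ G
  mul_mem : ∀ A ∈ G, ∀ B ∈ G, A * B ∈ G
  isCompact : @IsCompact _ (sot F) G
  continuous_mul :
    @ContinuousOn _ _ (@instTopologicalSpaceProd _ _ (sot F) (sot F)) (sot F)
      (fun p : (F →L[ℂ] F) × (F →L[ℂ] F) => p.1 * p.2) (G ×ˢ G)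
  exists_inv : ∃ inv : (F →L[ℂ] F) → (F →L[ℂ] F),
    (∀ A ∈ G, inv A ∈ G ∧ A * inv A = 1 ∧ inv A * A = 1) ∧
    @ContinuousOn _ _ (sot F) (sot F) inv G

/-- `P` is a Jacobs--de Leeuw--Glicksberg projection of the operator semigroup `A` on `F`. -/
structure IsJdLGProjection (A : Set (F →L[ℂ] F)) (P : F →L[ℂ] F) : Prop where
  isProjection : P * P = P
  mem_closure : P ∈ sotClosure A
  /-- The range of `P` is invariant under the closure of the semigroup. -/
  mapsTo_range : ∀ R ∈ sotClosure A, ∀ y ∈ P.range, R y ∈ P.range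
  /-- The kernel of `P` is invariant under the closure of the semigroup. -/
  mapsTo_ker : ∀ R ∈ sotClosure A, ∀ y ∈ P.ker, R y ∈ P.ker
  /-- Restricted to the range of `P`, the closure is a compact topological group. -/
  group_range : IsCompactTopGroup (restrictOps (sotClosure A) P.range)
  /-- Restricted to the kernel of `P`, the closure contains the zero operator. -/
  zero_mem_ker : 0 ∈ restrictOps (sotClosure A) P.ker

end Operators

end JdLG

/-! The strong closure of `𝒮` on `E_aap` is a compact abelian semigroup, and `P` is the idempotent
of its minimal ideal. If `𝒮x` is relatively compact, (i) holds because `E_aap` is an invariant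
subspace, and (ii) because its set is a continuous image of part of the orbit.

For the converse, let restricted operators `T` tend strongly to `P`. By (ii) the vectors `(1 - P)(x
- T x)` have a limit `y` in `ker P`, formally the `ker P` component of `x`. The identity `T'(x - T
x) = (x - T x) - (x - T' x) + T(x - T' x)` passes to the limit and shows that `x - y` has all its
differences in `rg P` (`exists_sub_mem_range`). As `y ∈ E_aap`, one may replace `x` by `x - y`.

On `rg P` the closure is a compact group. Hence, if the orbit is not totally bounded, operators `B ∈
𝒮` arbitrarily close to the identity on finite subsets of `rg P` move `x` by at least a fixed `δ`
(`totallyBounded_orbit_of_small`). If `B` almost fixes `x - T x`, then `(x - B x) + (x - T x)` is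
close to `x - B T x`, so suitable successive choices of `B` give vectors of norm at least `δ` with
bounded finite sums (`containsCZero_of_approx_translations`). By Bessaga–Pełczyński such a sequence
yields a copy of `c₀`. -/

namespace JdLG

/-! ### Bounded finite sums and copies of `c₀` -/

/-- Rosenthal's lemma for matrices with uniformly bounded row sums. -/
theorem exists_injective_offDiagonal_sum_le {ε : ℝ} (hε : 0 < ε) (m : ℕ) :
    ∀ a : ℕ → ℕ → ℝ, (∀ n k, 0 ≤ a n k) → (∀ n (F : Finset ℕ), ∑ k ∈ F, a n k ≤ m * ε) →
      ∃ φ : ℕ → ℕ, Function.Injective φ ∧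
        ∀ n (F : Finset ℕ), n ∉ F → ∑ k ∈ F, a (φ n) (φ k) ≤ ε := by
  induction m with
  | zero =>
    intro a _ h
    exact ⟨id, Function.injective_id, fun n F _ => (h n F).trans (by simpa using hε.le)⟩
  | succ m ih =>
    intro a ha h
    -- `Nat.pair` splits `ℕ` into infinitely many infinite blocks. If every block fails, each has a
    -- bad row; on the submatrix of these rows and columns, the row sums lose the mass `ε` spent
    -- inside the block.
    by_cases hp : ∃ p, ∀ n (F : Finset ℕ), n ∉ F →
        ∑ k ∈ F, a (Nat.pair p n) (Nat.pair p k) ≤ ε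
    · obtain ⟨p, hp⟩ := hp
      exact ⟨Nat.pair p, fun x y hxy => (Nat.pair_eq_pair.1 hxy).2, hp⟩
    · push Not at hp
      choose q G hq hG using hp
      have hinj : Function.Injective fun p => Nat.pair p (q p) :=
        fun x y hxy => (Nat.pair_eq_pair.1 hxy).1
      obtain ⟨φ, hφ, h'⟩ := ih (fun n k => a (Nat.pair n (q n)) (Nat.pair k (q k)))
        (fun _ _ => ha _ _) (fun n F => by
          -- The selected indices meet block `n` only in `Nat.pair n (q n)`, and `G n` omits `q n`.
          have hdisj : Disjoint (F.image fun p => Nat.pair p (q p)) ((G n).image (Nat.pair n)) := by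
            rw [Finset.disjoint_left]
            intro z hz hz'
            obtain ⟨p, -, rfl⟩ := Finset.mem_image.1 hz
            obtain ⟨k, hk, hkp⟩ := Finset.mem_image.1 hz'
            obtain ⟨rfl, rfl⟩ := Nat.pair_eq_pair.1 hkp
            exact hq _ hk
          have := h (Nat.pair n (q n)) ((F.image fun p => Nat.pair p (q p)) ∪ (G n).image (Nat.pair n))
          rw [Finset.sum_union hdisj, Finset.sum_image fun x _ y _ hxy => hinj hxy,
            Finset.sum_image fun x _ y _ hxy => (Nat.pair_eq_pair.1 hxy).2] at this
          have := hG n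
          push_cast at *
          linarith)
      exact ⟨fun n => Nat.pair (φ n) (q (φ n)), hinj.comp hφ, h'⟩

section

variable {E : Type*} [NormedAddCommGroup E] [NormedSpace ℂ E]

theorem sum_abs_le_of_sum_le (r : ℕ → ℝ) {C : ℝ} (h : ∀ F : Finset ℕ, |∑ k ∈ F, r k| ≤ C)
    (F : Finset ℕ) : ∑ k ∈ F, |r k| ≤ 2 * C := by
  have h1 := le_of_abs_le (h (F.filter fun k => 0 ≤ r k))
  have h2 := neg_le_of_abs_le (h (F.filter fun k => ¬ 0 ≤ r k))
  rw [← Finset.sum_filter_add_sum_filter_not F (fun k => 0 ≤ r k)]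
  rw [Finset.sum_congr rfl fun k hk => abs_of_nonneg (Finset.mem_filter.1 hk).2,
    Finset.sum_congr rfl (fun k hk => abs_of_neg (not_le.1 (Finset.mem_filter.1 hk).2)),
    Finset.sum_neg_distrib]
  linarith

/-- A series whose finite partial sums are bounded is weakly unconditionally Cauchy. -/
theorem sum_norm_apply_le {x : ℕ → E} {C : ℝ} (h : ∀ F : Finset ℕ, ‖∑ k ∈ F, x k‖ ≤ C)
    {f : StrongDual ℂ E} (hf : ‖f‖ ≤ 1) (F : Finset ℕ) : ∑ k ∈ F, ‖f (x k)‖ ≤ 4 * C := by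
  have hb : ∀ G : Finset ℕ, ‖∑ k ∈ G, f (x k)‖ ≤ C := fun G => by
    rw [← map_sum]
    exact (f.le_of_opNorm_le hf _).trans (by simpa using h G)
  have hre := sum_abs_le_of_sum_le (fun k => (f (x k)).re) (C := C) (fun G => by
    rw [← Complex.re_sum]; exact (Complex.abs_re_le_norm _).trans (hb G)) F
  have him := sum_abs_le_of_sum_le (fun k => (f (x k)).im) (C := C) (fun G => by
    rw [← Complex.im_sum]; exact (Complex.abs_im_le_norm _).trans (hb G)) F
  have := Finset.sum_le_sum fun k (_ : k ∈ F) => Complex.norm_le_abs_re_add_abs_im (f (x k))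
  rw [Finset.sum_add_distrib] at this
  linarith

theorem norm_sum_smul_le {x : ℕ → E} {C : ℝ} (h : ∀ F : Finset ℕ, ‖∑ k ∈ F, x k‖ ≤ C)
    (a : ℕ → ℂ) {b : ℝ} (F : Finset ℕ) (hb : ∀ k ∈ F, ‖a k‖ ≤ b) (hb0 : 0 ≤ b) :
    ‖∑ k ∈ F, a k • x k‖ ≤ 4 * C * b := by
  obtain ⟨f, hf, hfx⟩ := exists_dual_vector'' ℂ (∑ k ∈ F, a k • x k)
  have h1 : ‖∑ k ∈ F, a k • x k‖ = ‖∑ k ∈ F, a k * f (x k)‖ := by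
    have : f (∑ k ∈ F, a k • x k) = ∑ k ∈ F, a k * f (x k) := by simp
    rw [← this, hfx]; simp
  rw [h1]
  calc ‖∑ k ∈ F, a k * f (x k)‖ ≤ ∑ k ∈ F, ‖a k * f (x k)‖ := norm_sum_le _ _
    _ ≤ ∑ k ∈ F, b * ‖f (x k)‖ := Finset.sum_le_sum fun k hk => by
        rw [norm_mul]; exact mul_le_mul_of_nonneg_right (hb k hk) (norm_nonneg _)
    _ = b * ∑ k ∈ F, ‖f (x k)‖ := by rw [Finset.mul_sum]
    _ ≤ b * (4 * C) := mul_le_mul_of_nonneg_left (sum_norm_apply_le h hf F) hb0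
    _ = 4 * C * b := mul_comm _ _

theorem norm_apply_le_norm (a : C₀(ℕ, ℂ)) (k : ℕ) : ‖a k‖ ≤ ‖a‖ := by
  rw [← ZeroAtInftyContinuousMap.norm_toBCF_eq_norm]
  exact a.toBCF.norm_coe_le_norm k

theorem norm_le_of_apply_le (a : C₀(ℕ, ℂ)) {b : ℝ} (hb : 0 ≤ b) (h : ∀ k, ‖a k‖ ≤ b) :
    ‖a‖ ≤ b := by
  rw [← ZeroAtInftyContinuousMap.norm_toBCF_eq_norm]
  exact (BoundedContinuousFunction.norm_le hb).2 h

variable [CompleteSpace E]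

/-- Outside a finite set the coefficients are uniformly small, so `norm_sum_smul_le` gives the
Cauchy criterion. -/
theorem summable_smul {x : ℕ → E} {C : ℝ} (h : ∀ F : Finset ℕ, ‖∑ k ∈ F, x k‖ ≤ C)
    (a : C₀(ℕ, ℂ)) : Summable fun k => a k • x k := by
  have hC : 0 ≤ C := by simpa using h ∅
  rw [summable_iff_vanishing_norm]
  intro ε hε
  have hlim : Filter.Tendsto a Filter.cofinite (𝓝 0) := by
    have := ZeroAtInftyContinuousMapClass.zero_at_infty a
    rwa [Filter.cocompact_eq_cofinite] at this
  have hη : 0 < ε / (4 * C + 1) := by positivity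
  have hfin : {k | ¬ ‖a k‖ < ε / (4 * C + 1)}.Finite := by
    have := hlim.eventually (Metric.ball_mem_nhds 0 hη)
    simpa [Filter.eventually_cofinite] using this
  refine ⟨hfin.toFinset, fun t ht => ?_⟩
  refine (norm_sum_smul_le h a t (b := ε / (4 * C + 1)) (fun k hk => ?_) hη.le).trans_lt ?_
  · by_contra hk'
    exact Finset.disjoint_left.1 ht hk (by simpa using le_of_not_ge hk')
  · rw [mul_div_assoc', div_lt_iff₀ (by positivity)]
    nlinarith

/-- The Bessaga--Pełczyński theorem: a space with a sequence that is bounded below and has bounded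
finite sums contains `c₀`. -/
theorem containsCZero_of_bounded_sums {x : ℕ → E} {C δ : ℝ} (hδ : 0 < δ)
    (hx : ∀ k, δ ≤ ‖x k‖) (h : ∀ F : Finset ℕ, ‖∑ k ∈ F, x k‖ ≤ C) : ContainsCZero E := by
  have hex : ∀ k, ∃ f : StrongDual ℂ E, ‖f‖ ≤ 1 ∧ f (x k) = ‖x k‖ :=
    fun k => exists_dual_vector'' ℂ (x k)
  choose f hf hfx using hex
  obtain ⟨m, hm⟩ := exists_nat_ge (4 * C / (δ / 2))
  -- After passing to a subsequence, the functional norming `x (φ n)` is at least `δ` there, while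
  -- its values on the other terms sum to at most `δ / 2` in modulus.
  obtain ⟨φ, hφ, hoff⟩ := exists_injective_offDiagonal_sum_le (half_pos hδ) m
    (fun n k => ‖f n (x k)‖) (fun _ _ => norm_nonneg _) (fun n F =>
      (sum_norm_apply_le h (hf n) F).trans ((div_le_iff₀ (half_pos hδ)).1 hm))
  have h' : ∀ F : Finset ℕ, ‖∑ k ∈ F, x (φ k)‖ ≤ C := fun F => by
    simpa [Finset.sum_image fun a _ b _ hab => hφ hab] using h (F.image φ)
  have hs := fun a => summable_smul h' a
  let L : C₀(ℕ, ℂ) →ₗ[ℂ] E :=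
    { toFun := fun a => ∑' k, a k • x (φ k)
      map_add' := fun a b => by
        rw [← (hs a).tsum_add (hs b)]
        exact tsum_congr fun k => by simp [add_smul]
      map_smul' := fun c a => by
        rw [RingHom.id_apply, ← (hs a).tsum_const_smul c]
        exact tsum_congr fun k => by simp [mul_smul] }
  have hL : ∀ a, HasSum (fun k => a k • x (φ k)) (L a) := fun a => (hs a).hasSum
  have hupper : ∀ a, ‖L a‖ ≤ 4 * C * ‖a‖ := fun a =>
    le_of_tendsto (hL a).norm (Filter.Eventually.of_forall fun F =>
      norm_sum_smul_le h' a F (fun k _ => norm_apply_le_norm a k) (norm_nonneg a))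
  have hlower : ∀ a, ‖a‖ ≤ 2 / δ * ‖L a‖ := by
    intro a
    -- `f (φ n)` reads off the `n`-th coordinate up to an error `δ / 2 * ‖a‖`, which is absorbed on
    -- taking the supremum over `n`.
    have key : ∀ n, δ * ‖a n‖ ≤ ‖L a‖ + δ / 2 * ‖a‖ := by
      intro n
      have hsum : HasSum (fun k => a k * f (φ n) (x (φ k))) (f (φ n) (L a)) := by
        simpa using (f (φ n)).hasSum (hL a)
      have hle : ∀ F : Finset ℕ, n ∈ F →
          δ * ‖a n‖ ≤ ‖∑ k ∈ F, a k * f (φ n) (x (φ k))‖ + δ / 2 * ‖a‖ := by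
        intro F hn
        rw [← Finset.add_sum_erase F _ hn]
        have h1 : ‖∑ k ∈ F.erase n, a k * f (φ n) (x (φ k))‖ ≤ δ / 2 * ‖a‖ := by
          calc _ ≤ ∑ k ∈ F.erase n, ‖a k * f (φ n) (x (φ k))‖ := norm_sum_le _ _
            _ ≤ ∑ k ∈ F.erase n, ‖a‖ * ‖f (φ n) (x (φ k))‖ := Finset.sum_le_sum fun k _ => by
                rw [norm_mul]
                exact mul_le_mul_of_nonneg_right (norm_apply_le_norm a k) (norm_nonneg _)
            _ = ‖a‖ * ∑ k ∈ F.erase n, ‖f (φ n) (x (φ k))‖ := by rw [Finset.mul_sum]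
            _ ≤ ‖a‖ * (δ / 2) :=
                mul_le_mul_of_nonneg_left (hoff n _ (Finset.notMem_erase n F)) (norm_nonneg _)
            _ = _ := mul_comm _ _
        have h2 : δ * ‖a n‖ ≤ ‖a n * f (φ n) (x (φ n))‖ := by
          rw [norm_mul, hfx, Complex.norm_real, norm_norm, mul_comm]
          exact mul_le_mul_of_nonneg_left (hx _) (norm_nonneg _)
        have h3 := norm_sub_le_norm_add (a n * f (φ n) (x (φ n)))
          (∑ k ∈ F.erase n, a k * f (φ n) (x (φ k)))
        linarith
      have hlim := ge_of_tendsto (hsum.norm.add_const (δ / 2 * ‖a‖))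
        ((Filter.eventually_ge_atTop {n}).mono fun F hF => hle F (hF (Finset.mem_singleton_self n)))
      have := (f (φ n)).le_of_opNorm_le (hf _) (L a)
      linarith
    have := norm_le_of_apply_le a (b := (‖L a‖ + δ / 2 * ‖a‖) / δ) (by positivity)
      fun k => by rw [le_div_iff₀ hδ, mul_comm]; exact key k
    rw [le_div_iff₀ hδ] at this
    rw [div_mul_eq_mul_div, le_div_iff₀ hδ]
    linarith
  have hinj : Function.Injective L := (injective_iff_map_eq_zero L).2 fun a ha => by
    have := hlower a
    rw [ha, norm_zero, mul_zero] at this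
    exact norm_le_zero_iff.1 this
  refine ⟨LinearMap.range L, ⟨(LinearEquiv.ofInjective L hinj).toContinuousLinearEquivOfBounds
    (4 * C) (2 / δ) (fun a => hupper a) fun y => ?_⟩⟩
  obtain ⟨a, rfl⟩ := (LinearEquiv.ofInjective L hinj).surjective y
  simpa using hlower a

/-- A bounded set that approximately admits translations by vectors bounded below forces a copy of
`c₀`. -/
theorem containsCZero_of_approx_translations {D : Set E} {C δ : ℝ} (hδ : 0 < δ) (h0 : (0 : E) ∈ D)
    (hD : ∀ v ∈ D, ‖v‖ ≤ C)
    (h : ∀ J : Finset E, (J : Set E) ⊆ D → ∀ ε > 0, ∃ w : E, δ ≤ ‖w‖ ∧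
      ∀ v ∈ J, ∃ v' ∈ D, ‖w + v - v'‖ ≤ ε) : ContainsCZero E := by
  classical
  -- The finite set grows to contain approximations of all `w + v`, so the next vector is chosen to
  -- translate these too; the errors are summable.
  have step : ∀ (n : ℕ) (J : {J : Finset E // (J : Set E) ⊆ D}),
      ∃ (J' : {J : Finset E // (J : Set E) ⊆ D}) (w : E), δ ≤ ‖w‖ ∧ J.1 ⊆ J'.1 ∧
        ∀ v ∈ J.1, ∃ v' ∈ J'.1, ‖w + v - v'‖ ≤ (1 / 2) ^ n := by
    rintro n ⟨J, hJ⟩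
    obtain ⟨w, hw, hv⟩ := h J hJ ((1 / 2) ^ n) (by positivity)
    choose! t ht ht' using hv
    refine ⟨⟨J ∪ J.image t, ?_⟩, w, hw, Finset.subset_union_left, fun v hv =>
      ⟨t v, Finset.mem_union_right _ (Finset.mem_image_of_mem t hv), ht' v hv⟩⟩
    rw [Finset.coe_union, Finset.coe_image]
    exact Set.union_subset hJ (Set.image_subset_iff.2 ht)
  choose next w hw hsub hnext using step
  let J : ℕ → {J : Finset E // (J : Set E) ⊆ D} := fun n =>
    Nat.rec ⟨{0}, by simpa using h0⟩ (fun n J => next n J) n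
  have hJ : ∀ n, J (n + 1) = next n (J n) := fun n => rfl
  refine containsCZero_of_bounded_sums (x := fun n => w n (J n)) (C := 2 + C) hδ (fun n => hw _ _) ?_
  -- Every finite sum of the chosen vectors stays within distance 2 of the bounded set `D`: adding
  -- the last vector moves the approximant from `J n` to `J (n + 1)`.
  have key : ∀ n (F : Finset ℕ), F ⊆ Finset.range n → ∃ v ∈ (J n).1,
      ‖∑ k ∈ F, w k (J k) - v‖ ≤ ∑ k ∈ Finset.range n, (1 / 2 : ℝ) ^ k := by
    intro n
    induction n with
    | zero =>
      intro F hF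
      obtain rfl : F = ∅ := by simpa using hF
      exact ⟨0, by simp [J], by simp⟩
    | succ n ih =>
      intro F hF
      obtain ⟨v, hv, hle⟩ := ih (F.erase n) (fun k hk => by
        have := hF (Finset.mem_of_mem_erase hk)
        have := Finset.ne_of_mem_erase hk
        simp only [Finset.mem_range] at *
        omega)
      rw [Finset.sum_range_succ]
      by_cases hn : n ∈ F
      · obtain ⟨v', hv', hle'⟩ := hnext n (J n) v hv
        refine ⟨v', hJ n ▸ hv', ?_⟩
        rw [← Finset.add_sum_erase F _ hn]
        calc _ = ‖(∑ k ∈ F.erase n, w k (J k) - v) + (w n (J n) + v - v')‖ := by congr 1; abel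
          _ ≤ _ := (norm_add_le _ _).trans (add_le_add hle hle')
      · rw [Finset.erase_eq_of_notMem hn] at hle
        exact ⟨v, hJ n ▸ hsub n (J n) hv, hle.trans (le_add_of_nonneg_right (by positivity))⟩
  intro F
  obtain ⟨n, hn⟩ := F.exists_nat_subset_range
  obtain ⟨v, hv, hle⟩ := key n F hn
  have h1 : ∑ k ∈ Finset.range n, (1 / 2 : ℝ) ^ k ≤ 2 := sum_geometric_two_le n
  have h2 := hD v ((J n).2 hv)
  calc ‖∑ k ∈ F, w k (J k)‖ = ‖(∑ k ∈ F, w k (J k) - v) + v‖ := by rw [sub_add_cancel]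
    _ ≤ _ := norm_add_le _ _
    _ ≤ 2 + C := by linarith

end

/-! ### Idempotents in compact abelian semigroups -/

/-- The kernel of a compact abelian semigroup contains an idempotent `e` such that every element
`e * r` is invertible relative to `e`. -/
theorem exists_kernel_idempotent {M : Type*} [CommSemigroup M] [TopologicalSpace M] [CompactSpace M]
    [T2Space M] [Nonempty M] (hc : ∀ a : M, Continuous fun b => a * b) :
    ∃ e : M, e * e = e ∧ ∀ r, ∃ q, e * r * q = e := by
  have hcomp : ∀ a : M, IsCompact (Set.range fun b => a * b) := fun a => isCompact_range (hc a)
  -- The principal ideals `a * M` are compact and directed, since `(a * b) * M` lies in both `a * M`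
  -- and `b * M`; `k` lies in all of them.
  obtain ⟨k, hk⟩ := IsCompact.nonempty_iInter_of_directed_nonempty_isCompact_isClosed
    (fun a : M => Set.range fun b => a * b)
    (fun a b => ⟨a * b, by rintro _ ⟨c, rfl⟩; exact ⟨b * c, (mul_assoc a b c).symm⟩,
      by rintro _ ⟨c, rfl⟩; exact ⟨a * c, by simp only [mul_left_comm, mul_assoc]⟩⟩)
    (fun a => Set.range_nonempty _) hcomp fun a => (hcomp a).isClosed
  have hk' : ∀ a : M, ∃ b, a * b = k := fun a => Set.mem_iInter.1 hk a
  obtain ⟨m, hm⟩ := hk' (k * k)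
  have hek : k * m * k = k := by rw [mul_right_comm, hm]
  refine ⟨k * m, by rw [← mul_assoc, hek], fun r => ?_⟩
  obtain ⟨q, hq⟩ := hk' (k * r)
  refine ⟨k * (q * m), ?_⟩
  calc k * m * r * (k * (q * m)) = k * m * k * r * q * m := by
        simp only [mul_assoc, mul_left_comm]
    _ = k * m := by rw [hek, hq]

/-! ### The strong operator topology on bounded sets of operators -/

section

variable {F : Type*} [NormedAddCommGroup F] [NormedSpace ℂ F]

theorem tendsto_sot {ι : Type*} {l : Filter ι} {g : ι → F →L[ℂ] F} {T : F →L[ℂ] F} :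
    Filter.Tendsto g l (@nhds _ (sot F) T) ↔
      ∀ x, Filter.Tendsto (fun i => g i x) l (𝓝 (T x)) := by
  rw [nhds_induced, Filter.tendsto_comap_iff, tendsto_pi_nhds]
  rfl

theorem continuous_sot {X : Type*} [TopologicalSpace X] {g : X → F →L[ℂ] F} :
    @Continuous _ _ _ (sot F) g ↔ ∀ x, Continuous fun i => g i x := by
  rw [continuous_induced_rng, continuous_pi_iff]
  rfl

theorem continuous_sot_apply (x : F) :
    @Continuous _ _ (sot F) _ fun T : F →L[ℂ] F => T x :=
  @Continuous.comp _ _ _ (sot F) _ _ _ _ (continuous_apply x) continuous_induced_dom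

theorem t2Space_sot : @T2Space _ (sot F) :=
  @T2Space.of_injective_continuous _ _ (sot F) _ _ _ DFunLike.coe_injective continuous_induced_dom

theorem mem_sotClosure_iff {A : Set (F →L[ℂ] F)} {T : F →L[ℂ] F} :
    T ∈ sotClosure A ↔ ∃ u : Ultrafilter (F →L[ℂ] F), A ∈ u ∧
      ∀ x, Filter.Tendsto (fun R : F →L[ℂ] F => R x) u (𝓝 (T x)) := by
  rw [sotClosure, @mem_closure_iff_ultrafilter _ _ _ (sot F)]
  refine exists_congr fun u => and_congr_right fun _ => ?_
  rw [← tendsto_sot]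
  rfl

theorem subset_sotClosure {A : Set (F →L[ℂ] F)} : A ⊆ sotClosure A := @subset_closure _ (sot F) _

theorem isClosed_sotClosure {A : Set (F →L[ℂ] F)} : @IsClosed _ (sot F) (sotClosure A) :=
  @isClosed_closure _ (sot F) _

/-- Strongly closed conditions pass from a set of operators to its strong closure. -/
theorem sotClosure_induction {A : Set (F →L[ℂ] F)} {p : (F →L[ℂ] F) → Prop}
    (hp : @IsClosed _ (sot F) {T | p T}) (h : ∀ T ∈ A, p T) : ∀ T ∈ sotClosure A, p T :=
  fun _ hT => (@closure_minimal _ (sot F) _ _ h hp) hT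

theorem continuous_sot_mul_left (R : F →L[ℂ] F) :
    @Continuous _ _ (sot F) (sot F) fun T : F →L[ℂ] F => R * T :=
  (@continuous_sot _ _ _ _ (sot F) _).2 fun x =>
    @Continuous.comp _ _ _ (sot F) _ _ _ _ R.continuous (continuous_sot_apply x)

theorem continuous_sot_mul_right (R : F →L[ℂ] F) :
    @Continuous _ _ (sot F) (sot F) fun T : F →L[ℂ] F => T * R :=
  (@continuous_sot _ _ _ _ (sot F) _).2 fun x => continuous_sot_apply (R x)

theorem norm_le_of_mem_sotClosure {A : Set (F →L[ℂ] F)} {M : ℝ} (hM0 : 0 ≤ M)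
    (hM : ∀ T ∈ A, ‖T‖ ≤ M) : ∀ T ∈ sotClosure A, ‖T‖ ≤ M := by
  intro T hT
  refine T.opNorm_le_bound hM0 fun x => ?_
  refine sotClosure_induction (p := fun T => ‖T x‖ ≤ M * ‖x‖) ?_
    (fun T hT => T.le_of_opNorm_le (hM T hT) x) T hT
  exact @IsClosed.preimage _ _ (sot F) _ _ (continuous_sot_apply x) _
    (isClosed_le continuous_norm continuous_const)

theorem sotClosure_comm {A : Set (F →L[ℂ] F)} (h : ∀ R ∈ A, ∀ T ∈ A, R * T = T * R) :
    ∀ R ∈ sotClosure A, ∀ T ∈ sotClosure A, R * T = T * R := by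
  have h1 : ∀ R ∈ A, ∀ T ∈ sotClosure A, R * T = T * R := fun R hR =>
    sotClosure_induction (@isClosed_eq _ _ (sot F) (sot F) t2Space_sot _ _
      (continuous_sot_mul_left R) (continuous_sot_mul_right R)) (h R hR)
  intro R hR T hT
  exact sotClosure_induction (@isClosed_eq _ _ (sot F) (sot F) t2Space_sot _ _
    (continuous_sot_mul_right T) (continuous_sot_mul_left T)) (fun R hR => h1 R hR T hT) R hR

theorem sotClosure_mul_mem {A : Set (F →L[ℂ] F)} (h : ∀ R ∈ A, ∀ T ∈ A, R * T ∈ A) :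
    ∀ R ∈ sotClosure A, ∀ T ∈ sotClosure A, R * T ∈ sotClosure A := by
  have h1 : ∀ R ∈ A, ∀ T ∈ sotClosure A, R * T ∈ sotClosure A := fun R hR =>
    sotClosure_induction (@IsClosed.preimage _ _ (sot F) (sot F) _ (continuous_sot_mul_left R) _
      isClosed_sotClosure) fun T hT => subset_sotClosure (h R hR T hT)
  intro R hR T hT
  exact sotClosure_induction (@IsClosed.preimage _ _ (sot F) (sot F) _
    (continuous_sot_mul_right T) _ isClosed_sotClosure) (fun R hR => h1 R hR T hT) R hR

/-- A pointwise limit of a bounded family of operators is a bounded operator. -/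
theorem exists_clm_of_tendsto {ι : Type*} {l : Filter ι} [l.NeBot] {g : ι → F →L[ℂ] F} {M : ℝ}
    (hM : ∀ᶠ i in l, ‖g i‖ ≤ M) (h : ∀ x, ∃ y, Filter.Tendsto (fun i => g i x) l (𝓝 y)) :
    ∃ T : F →L[ℂ] F, ∀ x, Filter.Tendsto (fun i => g i x) l (𝓝 (T x)) := by
  choose f hf using h
  let L := linearMapOfTendsto f (fun i => (g i : F →ₗ[ℂ] F)) (tendsto_pi_nhds.2 hf)
  refine ⟨L.mkContinuous M fun x => ?_, hf⟩
  exact le_of_tendsto (hf x).norm (hM.mono fun i hi => (g i).le_of_opNorm_le hi x)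

/-- This is Tychonoff's theorem in ultrafilter form: compact orbit closures give pointwise limits,
and the norm bound makes the limit a bounded operator. -/
theorem isCompact_sotClosure {A : Set (F →L[ℂ] F)} {M : ℝ} (hM0 : 0 ≤ M) (hM : ∀ T ∈ A, ‖T‖ ≤ M)
    (hrel : ∀ x, RelCompact (orbit A x)) : @IsCompact _ (sot F) (sotClosure A) := by
  rw [@isCompact_iff_ultrafilter_le_nhds _ (sot F)]
  intro u hu
  have hu' : sotClosure A ∈ u := Filter.le_principal_iff.1 hu
  obtain ⟨T, hT⟩ := exists_clm_of_tendsto (l := (u : Filter (F →L[ℂ] F))) (g := id) (M := M)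
    (Filter.mem_of_superset hu' (norm_le_of_mem_sotClosure hM0 hM)) (fun x => by
      have hx : ∀ T ∈ sotClosure A, T x ∈ closure (orbit A x) :=
        sotClosure_induction (@IsClosed.preimage _ _ (sot F) _ _ (continuous_sot_apply x) _
          isClosed_closure) fun T hT => subset_closure ⟨T, hT, rfl⟩
      obtain ⟨y, -, hy⟩ := isCompact_iff_ultrafilter_le_nhds.1 (hrel x) (u.map fun T : F →L[ℂ] F => T x)
        (Filter.le_principal_iff.2 (Filter.mem_map.2 (Filter.mem_of_superset hu' hx)))
      exact ⟨y, hy⟩)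
  have hle : (u : Filter (F →L[ℂ] F)) ≤ @nhds _ (sot F) T := tendsto_sot.2 hT
  exact ⟨T, (@isClosed_iff_ultrafilter _ _ (sot F)).1 isClosed_sotClosure T u hle hu', hle⟩

theorem tendsto_apply_of_bounded {ι : Type*} {l : Filter ι} {f : ι → F →L[ℂ] F} {g : ι → F} {M : ℝ}
    (hM : ∀ᶠ i in l, ‖f i‖ ≤ M) {w w' : F} (hg : Filter.Tendsto g l (𝓝 w))
    (hf : Filter.Tendsto (fun i => f i w) l (𝓝 w')) :
    Filter.Tendsto (fun i => f i (g i)) l (𝓝 w') := by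
  have h0 : Filter.Tendsto (fun i => f i (g i - w)) l (𝓝 0) := by
    refine squeeze_zero_norm' (a := fun i => M * ‖g i - w‖)
      (hM.mono fun i hi => (f i).le_of_opNorm_le hi _) ?_
    simpa using (tendsto_iff_norm_sub_tendsto_zero.1 hg).const_mul M
  simpa using h0.add hf

/-- A bounded strongly compact set of operators that is an algebraic group is a compact topological
group for the strong operator topology. -/
theorem isCompactTopGroup_of_bounded {G : Set (F →L[ℂ] F)} {M : ℝ} (hM : ∀ T ∈ G, ‖T‖ ≤ M)
    (hone : 1 ∈ G) (hmul : ∀ A ∈ G, ∀ B ∈ G, A * B ∈ G) (hcomp : @IsCompact _ (sot F) G)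
    (hinv : ∀ A ∈ G, ∃ B ∈ G, A * B = 1 ∧ B * A = 1) : IsCompactTopGroup G where
  one_mem := hone
  mul_mem := hmul
  isCompact := hcomp
  continuous_mul := by
    let _ : TopologicalSpace ((F →L[ℂ] F) × (F →L[ℂ] F)) :=
      @instTopologicalSpaceProd _ _ (sot F) (sot F)
    rintro p -
    refine tendsto_sot.2 fun x => ?_
    have h1 := tendsto_sot.1 (Filter.Tendsto.mono_left (@Continuous.tendsto _ _ _ (sot F) _
      (@continuous_fst _ _ (sot F) (sot F)) p) (nhdsWithin_le_nhds (s := G ×ˢ G)))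
    have h2 := tendsto_sot.1 (Filter.Tendsto.mono_left (@Continuous.tendsto _ _ _ (sot F) _
      (@continuous_snd _ _ (sot F) (sot F)) p) (nhdsWithin_le_nhds (s := G ×ˢ G)))
    exact tendsto_apply_of_bounded (M := M) (f := fun q : (F →L[ℂ] F) × (F →L[ℂ] F) => q.1)
      (g := fun q => q.2 x)
      (Filter.mem_of_superset self_mem_nhdsWithin fun q hq => hM _ hq.1) (h2 x) (h1 _)
  exists_inv := by
    choose! inv hinv using hinv
    refine ⟨inv, hinv, fun A hA => tendsto_sot.2 fun x => ?_⟩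
    have hle : Filter.Tendsto id (@nhdsWithin _ (sot F) A G) (@nhds _ (sot F) A) :=
      @nhdsWithin_le_nhds _ (sot F) A G
    have hid := tendsto_sot.1 hle
    have hmem : G ∈ @nhdsWithin _ (sot F) A G := @self_mem_nhdsWithin _ (sot F) A G
    -- Since `inv B - inv A = inv B * (A - B) * inv A` and `‖inv B‖ ≤ M`, continuity of inversion at
    -- `A` reduces to convergence at the vector `inv A x`.
    have hlim : Filter.Tendsto (fun B : F →L[ℂ] F => A (inv A x) - B (inv A x))
        (@nhdsWithin _ (sot F) A G) (𝓝 0) := by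
      simpa using (tendsto_const_nhds (x := A (inv A x))).sub (hid (inv A x))
    rw [tendsto_iff_norm_sub_tendsto_zero]
    refine squeeze_zero_norm' (a := fun B : F →L[ℂ] F => M * ‖A (inv A x) - B (inv A x)‖) ?_
      (by simpa using hlim.norm.const_mul M)
    refine Filter.mem_of_superset hmem fun B hB => ?_
    have h1 : inv B (A (inv A x) - B (inv A x)) = inv B x - inv A x := by
      rw [map_sub]
      congr 1
      · exact congrArg (inv B) (DFunLike.congr_fun (hinv A hA).2.1 x)
      · exact DFunLike.congr_fun (hinv B hB).2.2 (inv A x)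
    have h2 := (inv B).le_of_opNorm_le (hM _ (hinv B hB).1) (A (inv A x) - B (inv A x))
    rw [h1] at h2
    simpa using h2

/-- The compression of an operator to the range of `P`. -/
noncomputable def compress (P R : F →L[ℂ] F) : P.range →L[ℂ] P.range :=
  ((P * R) ∘L P.range.subtypeL).codRestrict P.range fun v => ⟨R v, rfl⟩

theorem compress_apply (P R : F →L[ℂ] F) (v : P.range) : (compress P R v : F) = P (R v) := rfl

theorem apply_of_mem_range {P : F →L[ℂ] F} (hP : P * P = P) {y : F} (hy : y ∈ P.range) :
    P y = y := by
  obtain ⟨z, rfl⟩ := hy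
  exact DFunLike.congr_fun hP z

theorem continuous_sot_compress (P : F →L[ℂ] F) :
    @Continuous _ _ (sot F) (sot P.range) (compress P) := by
  refine (@continuous_sot _ _ _ _ (sot F) _).2 fun v => ?_
  exact @Continuous.subtype_mk _ _ _ (sot F) _ _
    (@Continuous.comp _ _ _ (sot F) _ _ _ _ P.continuous (continuous_sot_apply _)) _

/-! ### The Jacobs–de Leeuw–Glicksberg projection -/

/-- The Jacobs--de Leeuw--Glicksberg decomposition of a bounded abelian operator semigroup with
relatively compact orbits. -/
theorem exists_isJdLGProjection {A : Set (F →L[ℂ] F)} (hne : A.Nonempty)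
    (hmul : ∀ R ∈ A, ∀ T ∈ A, R * T ∈ A) (hcomm : ∀ R ∈ A, ∀ T ∈ A, R * T = T * R) {M : ℝ}
    (hM0 : 0 ≤ M) (hM : ∀ T ∈ A, ‖T‖ ≤ M) (hrel : ∀ x, RelCompact (orbit A x)) :
    ∃ P, IsJdLGProjection A P := by
  have hcomp := isCompact_sotClosure hM0 hM hrel
  have hmul' := sotClosure_mul_mem hmul
  have hcomm' := sotClosure_comm hcomm
  have hM' := norm_le_of_mem_sotClosure hM0 hM
  obtain ⟨⟨P, hP⟩, hidem, hinv⟩ : ∃ e : sotClosure A, e.1 * e.1 = e.1 ∧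
      ∀ r : sotClosure A, ∃ q : sotClosure A, e.1 * r.1 * q.1 = e.1 := by
    have := @exists_kernel_idempotent (sotClosure A)
      { mul := fun a b => ⟨a.1 * b.1, hmul' _ a.2 _ b.2⟩
        mul_assoc := fun a b c => Subtype.ext (mul_assoc _ _ _)
        mul_comm := fun a b => Subtype.ext (hcomm' _ a.2 _ b.2) }
      (@instTopologicalSpaceSubtype _ _ (sot F))
      ((@isCompact_iff_compactSpace _ (sot F) _).1 hcomp)
      (@instT2SpaceSubtype _ (sot F) _ t2Space_sot)
      (hne.mono subset_sotClosure).to_subtype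
      (fun a => @Continuous.subtype_mk _ _ (sot F) (@instTopologicalSpaceSubtype _ _ (sot F)) _ _
        (@Continuous.comp _ _ _ (@instTopologicalSpaceSubtype _ _ (sot F)) (sot F) (sot F) _ _
          (continuous_sot_mul_left a.1) (@continuous_subtype_val _ (sot F) _)) _)
    obtain ⟨e, he, hq⟩ := this
    exact ⟨e, congrArg Subtype.val he, fun r => (hq r).imp fun q h => congrArg Subtype.val h⟩
  simp only [Subtype.forall, Subtype.exists, exists_prop] at hinv hidem
  have hPR : ∀ R ∈ sotClosure A, ∀ v, P (R v) = R (P v) := fun R hR v =>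
    DFunLike.congr_fun (hcomm' P hP R hR) v
  have hrange : ∀ R ∈ sotClosure A, ∀ y ∈ P.range, R y ∈ P.range := by
    rintro R hR _ ⟨z, rfl⟩
    exact ⟨R z, hPR R hR z⟩
  -- Compression, unlike restriction, is defined and strongly continuous on all operators, so
  -- compactness carries over to the restrictions.
  have himage : restrictOps (sotClosure A) P.range = compress P '' sotClosure A := by
    ext B
    constructor
    · rintro ⟨R, hR, hB⟩
      refine ⟨R, hR, ContinuousLinearMap.ext fun v => Subtype.ext ?_⟩
      rw [hB, compress_apply, apply_of_mem_range hidem (hrange R hR v v.2)]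
    · rintro ⟨R, hR, rfl⟩
      exact ⟨R, hR, fun v => apply_of_mem_range hidem (hrange R hR v v.2)⟩
  -- `P` itself restricts to zero on its kernel.
  refine ⟨P, hidem, hP, hrange, ?_, ?_, P, hP, fun v => v.2.symm⟩
  · intro R hR y hy
    have hy' : P y = 0 := hy
    change P (R y) = 0
    rw [hPR R hR, hy', map_zero]
  · refine isCompactTopGroup_of_bounded (M := M) ?_ ⟨P, hP, fun v => ?_⟩ ?_ ?_ ?_
    · rintro B ⟨R, hR, hB⟩
      refine B.opNorm_le_bound hM0 fun v => ?_
      change ‖(B v : F)‖ ≤ M * ‖(v : F)‖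
      rw [hB]
      exact R.le_of_opNorm_le (hM' R hR) _
    · exact (apply_of_mem_range hidem v.2).symm
    · rintro B ⟨R, hR, hB⟩ B' ⟨R', hR', hB'⟩
      refine ⟨R * R', hmul' R hR R' hR', fun v => ?_⟩
      change (B (B' v) : F) = R (R' v)
      rw [hB, hB']
    · rw [himage]
      exact @IsCompact.image _ _ (sot F) (sot P.range) _ _ hcomp (continuous_sot_compress P)
    · rintro B ⟨R, hR, hB⟩
      obtain ⟨Q, hQ, hPQ⟩ := hinv R hR
      have hid : ∀ v : P.range, R (Q v) = v := fun v => by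
        have h1 : P (R (Q v)) = P v := DFunLike.congr_fun hPQ (v : F)
        rwa [apply_of_mem_range hidem v.2,
          apply_of_mem_range hidem (hrange R hR _ (hrange Q hQ v v.2))] at h1
      have hval : ∀ v : P.range, (compress P Q v : F) = Q v := fun v =>
        apply_of_mem_range hidem (hrange Q hQ v v.2)
      refine ⟨compress P Q, ⟨Q, hQ, hval⟩, ContinuousLinearMap.ext fun v => Subtype.ext ?_,
        ContinuousLinearMap.ext fun v => Subtype.ext ?_⟩
      · change (B (compress P Q v) : F) = v
        rw [hB, hval, hid]
      · change (compress P Q (B v) : F) = v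
        rw [hval, hB]
        exact (DFunLike.congr_fun (hcomm' Q hQ R hR) (v : F)).trans (hid v)

/-- The group inverse is itself the restriction of an operator in the closure, which therefore obeys
the semigroup's norm bounds and is a strong limit of its elements. -/
theorem IsJdLGProjection.exists_inverse {A : Set (F →L[ℂ] F)} {P : F →L[ℂ] F}
    (hP : IsJdLGProjection A P) {R : F →L[ℂ] F} (hR : R ∈ sotClosure A) :
    ∃ Q ∈ sotClosure A, ∀ v ∈ P.range, Q (R v) = v := by
  obtain ⟨inv, hinv, -⟩ := hP.group_range.exists_inv
  let B : P.range →L[ℂ] P.range :=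
    (R ∘L P.range.subtypeL).codRestrict P.range fun v => hP.mapsTo_range R hR v v.2
  obtain ⟨⟨Q, hQ, hQv⟩, -, h⟩ := hinv B ⟨R, hR, fun v => rfl⟩
  refine ⟨Q, hQ, fun v hv => ?_⟩
  have h1 := congrArg Subtype.val (DFunLike.congr_fun h ⟨v, hv⟩)
  exact (hQv (B ⟨v, hv⟩)).symm.trans h1

/-- An idempotent that is invertible on `rg P` is the identity there, so `P' * P = P`; by symmetry
`P * P' = P'`, and the two commute. -/
theorem IsJdLGProjection.unique {A : Set (F →L[ℂ] F)}
    (hcomm : ∀ R ∈ A, ∀ T ∈ A, R * T = T * R) {P P' : F →L[ℂ] F} (hP : IsJdLGProjection A P)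
    (hP' : IsJdLGProjection A P') : P = P' := by
  have key : ∀ {P P' : F →L[ℂ] F}, IsJdLGProjection A P → IsJdLGProjection A P' → P' * P = P := by
    intro P P' hP hP'
    obtain ⟨Q, -, hQ⟩ := hP.exists_inverse hP'.mem_closure
    ext z
    have h1 := hQ (P z) ⟨z, rfl⟩
    have h2 := hQ (P' (P z)) (hP.mapsTo_range _ hP'.mem_closure _ ⟨z, rfl⟩)
    rw [← mul_apply_eq_comp P' P', hP'.isProjection, h1] at h2
    exact h2.symm
  rw [← key hP hP', sotClosure_comm hcomm _ hP'.mem_closure _ hP.mem_closure, key hP' hP]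

end

theorem relCompact_iff_totallyBounded {X : Type*} [UniformSpace X] [CompleteSpace X] {A : Set X} :
    RelCompact A ↔ TotallyBounded A :=
  ⟨fun h => h.totallyBounded.subset subset_closure,
    fun h => h.closure.isCompact_of_isClosed isClosed_closure⟩

/-! ### Restriction of the semigroup to `E_aap` -/

section

variable {E : Type*} [NormedAddCommGroup E] [NormedSpace ℂ E]

theorem isClosed_aap [CompleteSpace E] {S : Set (E →L[ℂ] E)} {M : ℝ} (hM : ∀ T ∈ S, ‖T‖ ≤ M) :
    IsClosed (aap S : Set E) := by
  refine isClosed_of_closure_subset fun x hx => ?_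
  refine relCompact_iff_totallyBounded.2 (Metric.totallyBounded_iff.2 fun ε hε => ?_)
  obtain ⟨z, hz, hxz⟩ := Metric.mem_closure_iff.1 hx (ε / 2 / (|M| + 1)) (by positivity)
  obtain ⟨t, ht, hcov⟩ := Metric.totallyBounded_iff.1
    (relCompact_iff_totallyBounded.1 (mem_aap.1 hz)) (ε / 2) (half_pos hε)
  refine ⟨t, ht, ?_⟩
  rintro _ ⟨T, hT, rfl⟩
  obtain ⟨y, hy, hTy⟩ := Set.mem_iUnion₂.1 (hcov ⟨T, hT, rfl⟩)
  refine Set.mem_iUnion₂.2 ⟨y, hy, ?_⟩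
  rw [Metric.mem_ball] at hTy ⊢
  have h1 : dist (T x) (T z) ≤ (|M| + 1) * dist x z := by
    rw [dist_eq_norm, dist_eq_norm, ← map_sub]
    exact T.le_of_opNorm_le ((hM T hT).trans (by linarith [le_abs_self M])) _
  rw [lt_div_iff₀ (by positivity)] at hxz
  have := dist_triangle (T x) (T z) y
  linarith

section Restriction

variable (S : Subsemigroup (E →L[ℂ] E))

/-- The restriction of an element of the semigroup to the space of vectors with relatively compact
orbit. -/
noncomputable def restrictAap {T : E →L[ℂ] E} (hT : T ∈ S) :
    aap (S : Set (E →L[ℂ] E)) →L[ℂ] aap (S : Set (E →L[ℂ] E)) :=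
  (T ∘L (aap (S : Set (E →L[ℂ] E))).subtypeL).codRestrict _ fun v => mapsTo_aap S hT v.2

/-- The restriction of the semigroup to the space of vectors with relatively compact orbit. -/
abbrev aapOps : Set (aap (S : Set (E →L[ℂ] E)) →L[ℂ] aap (S : Set (E →L[ℂ] E))) :=
  restrictOps (S : Set (E →L[ℂ] E)) (aap (S : Set (E →L[ℂ] E)))

variable {S}

theorem restrictAap_mem {T : E →L[ℂ] E} (hT : T ∈ S) : restrictAap S hT ∈ aapOps S :=
  ⟨T, hT, fun _ => rfl⟩

theorem aapOps_mul_mem : ∀ R ∈ aapOps S, ∀ R' ∈ aapOps S, R * R' ∈ aapOps S := by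
  rintro R ⟨T, hT, hR⟩ R' ⟨T', hT', hR'⟩
  refine ⟨T * T', S.mul_mem hT hT', fun v => ?_⟩
  change (R (R' v) : E) = T (T' v)
  rw [hR, hR']

theorem aapOps_comm (hab : ∀ A ∈ S, ∀ B ∈ S, A * B = B * A) :
    ∀ R ∈ aapOps S, ∀ R' ∈ aapOps S, R * R' = R' * R := by
  rintro R ⟨T, hT, hR⟩ R' ⟨T', hT', hR'⟩
  refine ContinuousLinearMap.ext fun v => Subtype.ext ?_
  change (R (R' v) : E) = R' (R v)
  rw [hR, hR', hR', hR]
  exact DFunLike.congr_fun (hab T hT T' hT') (v : E)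

theorem aapOps_norm_le {M : ℝ} (hM0 : 0 ≤ M) (hM : ∀ T ∈ S, ‖T‖ ≤ M) :
    ∀ R ∈ aapOps S, ‖R‖ ≤ M := by
  rintro R ⟨T, hT, hR⟩
  refine R.opNorm_le_bound hM0 fun v => ?_
  change ‖(R v : E)‖ ≤ M * ‖(v : E)‖
  rw [hR]
  exact T.le_of_opNorm_le (hM T hT) _

variable [CompleteSpace E]

theorem isCompact_coe_preimage {M : ℝ} (hM : ∀ T ∈ S, ‖T‖ ≤ M) {K : Set E} (hK : IsCompact K) :
    IsCompact ((↑) ⁻¹' K : Set (aap (S : Set (E →L[ℂ] E)))) :=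
  (isClosed_aap hM).isClosedEmbedding_subtypeVal.isCompact_preimage hK

theorem relCompact_orbit_aapOps {M : ℝ} (hM : ∀ T ∈ S, ‖T‖ ≤ M) (v : aap (S : Set (E →L[ℂ] E))) :
    RelCompact (orbit (aapOps S) v) := by
  refine relCompact_of_subset (isCompact_coe_preimage hM (mem_aap.1 v.2)) ?_
  rintro _ ⟨R, ⟨T, hT, hR⟩, rfl⟩
  exact subset_closure ⟨T, hT, hR v⟩

variable {M : ℝ} (hM0 : 0 ≤ M) (hM : ∀ T ∈ S, ‖T‖ ≤ M)
  {P : aap (S : Set (E →L[ℂ] E)) →L[ℂ] aap (S : Set (E →L[ℂ] E))}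
  (hP : IsJdLGProjection (aapOps S) P)

include hM in
-- The set is the image of the orbit of `x` under the continuous map `z ↦ (1 - P)(x - z)`.
theorem relCompact_of_mem_aap {x : E} (hx : x ∈ aap (S : Set (E →L[ℂ] E)))
    (h : ∀ T ∈ S, RelCompact (orbit S ((1 - T) x))) :
    RelCompact {y : E | ∃ (T : E →L[ℂ] E) (hT : T ∈ S),
      y = ((1 - P) ⟨(1 - T) x, mem_aap.2 (h T hT)⟩ : aap (S : Set (E →L[ℂ] E)))} := by
  refine relCompact_of_subset ((isCompact_coe_preimage hM (mem_aap.1 hx)).image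
    (f := fun z => (((1 - P) (⟨x, hx⟩ - z) : aap (S : Set (E →L[ℂ] E))) : E)) ?_) ?_
  · exact continuous_subtype_val.comp ((1 - P).continuous.comp (continuous_const.sub continuous_id))
  · rintro _ ⟨T, hT, rfl⟩
    exact ⟨⟨T x, mapsTo_aap S hT hx⟩, subset_closure ⟨T, hT, rfl⟩, rfl⟩

/-! ### Removing the component in `ker P` -/

include hM hP in
/-- Subtracting a vector of the kernel of `P` moves all differences `x - T x` into the range
of `P`. -/
theorem exists_sub_mem_range (hab : ∀ A ∈ S, ∀ B ∈ S, A * B = B * A) {x : E}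
    (h : ∀ T ∈ S, RelCompact (orbit S ((1 - T) x)))
    (hK : RelCompact {y : E | ∃ (T : E →L[ℂ] E) (hT : T ∈ S),
      y = ((1 - P) ⟨(1 - T) x, mem_aap.2 (h T hT)⟩ : aap (S : Set (E →L[ℂ] E)))}) :
    ∃ y : aap (S : Set (E →L[ℂ] E)), ∀ T ∈ S, ∃ r ∈ P.range, (r : E) = (x - y) - T (x - y) := by
  have hcomm := sotClosure_comm (aapOps_comm hab)
  have hPR : ∀ R ∈ aapOps S, ∀ v, P (R v) = R (P v) := fun R hR v =>
    DFunLike.congr_fun (hcomm P hP.mem_closure R (subset_sotClosure hR)) v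
  have hPP : ∀ v, P (P v) = P v := fun v => DFunLike.congr_fun hP.isProjection v
  let c : ∀ T ∈ S, aap (S : Set (E →L[ℂ] E)) := fun T hT => ⟨(1 - T) x, mem_aap.2 (h T hT)⟩
  -- `w` is an ultrafilter on the restricted semigroup tending strongly to `P`; `y` will be the
  -- limit along it of `(1 - P)(x - T x)`.
  obtain ⟨w, hAw, hw⟩ := mem_sotClosure_iff.1 hP.mem_closure
  have hex : ∀ B, ∃ z : aap (S : Set (E →L[ℂ] E)), B ∈ aapOps S →
      ∃ (T : E →L[ℂ] E) (hT : T ∈ S), (∀ v, (B v : E) = T v) ∧ z = c T hT - P (c T hT) := by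
    intro B
    by_cases hB : B ∈ aapOps S
    · obtain ⟨T, hT, hBT⟩ := hB
      exact ⟨_, fun _ => ⟨T, hT, hBT, rfl⟩⟩
    · exact ⟨0, fun hB' => (hB hB').elim⟩
  choose z hz using hex
  obtain ⟨y, -, hy⟩ := isCompact_iff_ultrafilter_le_nhds.1 (isCompact_coe_preimage hM hK) (w.map z)
    (Filter.le_principal_iff.2 (Filter.mem_map.2 (Filter.mem_of_superset hAw fun B hB => by
      obtain ⟨T, hT, -, hzT⟩ := hz B hB
      exact subset_closure ⟨T, hT, congrArg Subtype.val hzT⟩)))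
  have hy : Filter.Tendsto z w (𝓝 y) := hy
  have hPy : P y = 0 := by
    refine tendsto_nhds_unique ((P.continuous.tendsto y).comp hy)
      (tendsto_const_nhds.congr' (Filter.mem_of_superset hAw fun B hB => ?_))
    obtain ⟨T, hT, -, hzT⟩ := hz B hB
    change 0 = P (z B)
    rw [hzT, map_sub, hPP, sub_self]
  refine ⟨y, fun T hT => ⟨c T hT - y + restrictAap S hT y, ?_, ?_⟩⟩
  · have key : c T hT - P (c T hT) - y + restrictAap S hT y = P (c T hT - P (c T hT)) := by
      refine tendsto_nhds_unique (((tendsto_const_nhds (x := c T hT - P (c T hT))).sub hy).add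
        (((restrictAap S hT).continuous.tendsto y).comp hy))
        ((hw (c T hT - P (c T hT))).congr' (Filter.mem_of_superset hAw fun B hB => ?_))
      obtain ⟨T', hT', hBT', hzT'⟩ := hz B hB
      have h1 : B (c T hT) = c T hT - c T' hT' + restrictAap S hT (c T' hT') := by
        refine Subtype.ext ?_
        have h2 : T' (T x) = T (T' x) := DFunLike.congr_fun (hab T' hT' T hT) x
        rw [hBT']
        change T' (x - T x) = (x - T x) - (x - T' x) + T (x - T' x)
        rw [map_sub, map_sub, h2]
        abel
      change B (c T hT - P (c T hT)) = c T hT - P (c T hT) - z B + restrictAap S hT (z B)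
      rw [hzT', map_sub, map_sub, ← hPR B hB, ← hPR _ (restrictAap_mem hT), h1, map_add, map_sub]
      abel
    refine ⟨c T hT, ?_⟩
    rw [map_sub, hPP, sub_self] at key
    change P (c T hT) = _
    rw [← sub_eq_zero, ← neg_eq_zero, ← key]
    abel
  · change (x - T x) - (y : E) + T y = _
    rw [map_sub]
    abel

/-! ### Total boundedness and the Bohl–Bohr–Kadets argument -/

include hM0 hM hP in
/-- If the differences `x - T x` lie in the range of `P` and are small whenever `T` is near the
identity on a finite set, then the orbit of `x` is totally bounded. -/
theorem totallyBounded_orbit_of_small {x : E}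
    (hx : ∀ T ∈ S, ∃ r ∈ P.range, (r : E) = x - T x)
    (hsmall : ∀ δ > 0, ∃ J : Finset (aap (S : Set (E →L[ℂ] E))), (∀ v ∈ J, v ∈ P.range) ∧
      ∃ ε > 0, ∀ B ∈ S, (∀ v ∈ J, ‖(v : E) - B v‖ < ε) → ‖x - B x‖ < δ) :
    TotallyBounded (orbit S x) := by
  have hA := aapOps_norm_le hM0 hM
  have hcomp := isCompact_sotClosure hM0 hA (relCompact_orbit_aapOps hM)
  refine totallyBounded_iff_ultrafilter.2 fun f hf => Metric.cauchy_iff.2 ⟨f.neBot, fun η hη => ?_⟩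
  have hf : orbit S x ∈ f := Filter.le_principal_iff.1 hf
  have hex : ∀ y, ∃ (T : E →L[ℂ] E)
      (R : aap (S : Set (E →L[ℂ] E)) →L[ℂ] aap (S : Set (E →L[ℂ] E))),
      y ∈ orbit S x → T ∈ S ∧ y = T x ∧ R ∈ aapOps S ∧ ∀ v, (R v : E) = T v := by
    intro y
    by_cases hy : y ∈ orbit S x
    · obtain ⟨T, hT, hyT⟩ := hy
      exact ⟨T, restrictAap S hT, fun _ => ⟨hT, hyT, restrictAap_mem hT, fun _ => rfl⟩⟩
    · exact ⟨0, 0, fun hy' => (hy hy').elim⟩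
  choose T R hTR using hex
  -- Along the ultrafilter the restricted operators converge to some `U`. A semigroup element `L`
  -- close to the inverse of `U` on `J` then makes `L * T y` almost fix `J`, so `L y` is near `x`.
  obtain ⟨U, hU, hfU⟩ := (@isCompact_iff_ultrafilter_le_nhds _ (sot _) _).1 hcomp (f.map R)
    (Filter.le_principal_iff.2 (Filter.mem_map.2 (Filter.mem_of_superset hf fun y hy =>
      subset_sotClosure (hTR y hy).2.2.1)))
  have hfU : ∀ v, Filter.Tendsto (fun y => R y v) f (𝓝 (U v)) := tendsto_sot.1 hfU
  obtain ⟨Q, hQ, hQU⟩ := hP.exists_inverse hU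
  obtain ⟨q, hAq, hq⟩ := mem_sotClosure_iff.1 hQ
  obtain ⟨J, hJ, ε, hε, hB⟩ := hsmall (η / (2 * (M + 1))) (by positivity)
  obtain ⟨A, ⟨L, hL, hAL⟩, hAJ⟩ : ∃ A ∈ aapOps S, ∀ v ∈ J, ‖v - A (U v)‖ < ε := by
    have h1 : ∀ᶠ A in (q : Filter (aap (S : Set (E →L[ℂ] E)) →L[ℂ] aap (S : Set (E →L[ℂ] E)))),
        ∀ v ∈ J, ‖v - A (U v)‖ < ε := by
      refine (Filter.eventually_all_finset J).2 fun v hv => ?_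
      have h2 := ((tendsto_const_nhds (x := v)).sub (hq (U v))).norm
      rw [hQU v (hJ v hv), sub_self, norm_zero] at h2
      exact h2.eventually (gt_mem_nhds hε)
    obtain ⟨A, hA1, hA2⟩ := (Filter.Eventually.and (Filter.eventually_iff.2 hAq) h1).exists
    exact ⟨A, hA1, hA2⟩
  have hnear : ∀ᶠ y in (f : Filter E), ∀ v ∈ J, ‖v - A (R y v)‖ < ε := by
    refine (Filter.eventually_all_finset J).2 fun v hv => ?_
    have h2 := ((tendsto_const_nhds (x := v)).sub ((A.continuous.tendsto _).comp (hfU v))).norm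
    exact h2.eventually (gt_mem_nhds (hAJ v hv))
  obtain ⟨Q', hQ', hQA⟩ := hP.exists_inverse (subset_sotClosure ⟨L, hL, hAL⟩)
  have hsm : ∀ y ∈ orbit S x, (∀ v ∈ J, ‖v - A (R y v)‖ < ε) → ‖x - L y‖ < η / (2 * (M + 1)) := by
    intro y hy hyJ
    obtain ⟨hTy, hyT, -, hRT⟩ := hTR y hy
    have := hB (L * T y) (S.mul_mem hL hTy) fun v hv => by
      have := hyJ v hv
      change ‖(v : E) - A (R y v)‖ < ε at this
      rwa [hAL, hRT] at this
    rwa [mul_apply_eq_comp, ← hyT] at this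
  refine ⟨_, Filter.inter_mem hf hnear, ?_⟩
  rintro y ⟨hy, hyJ⟩ y' ⟨hy', hyJ'⟩
  have h1 := hsm y hy hyJ
  have h2 := hsm y' hy' hyJ'
  obtain ⟨r, hr, hry⟩ := hx (T y) (hTR y hy).1
  obtain ⟨r', hr', hry'⟩ := hx (T y') (hTR y' hy').1
  rw [← (hTR y hy).2.1] at hry
  rw [← (hTR y' hy').2.1] at hry'
  have hsub : ((r' - r : aap (S : Set (E →L[ℂ] E))) : E) = y - y' := by
    rw [Submodule.coe_sub, hry, hry']
    abel
  -- The difference `y - y'` lies in `rg P`, where `L` is undone by an operator of norm at most `M`;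
  -- closeness of `L y` and `L y'` thus passes back to `y` and `y'`.
  have h3 : ‖y - y'‖ ≤ M * ‖L (y - y')‖ := by
    have := Q'.le_of_opNorm_le (norm_le_of_mem_sotClosure hM0 hA Q' hQ') (A (r' - r))
    rw [hQA _ (sub_mem hr' hr)] at this
    change ‖((r' - r : aap (S : Set (E →L[ℂ] E))) : E)‖ ≤ M * ‖(A (r' - r) : E)‖ at this
    rwa [hAL, hsub] at this
  have h4 : ‖L (y - y')‖ < η / (M + 1) := by
    calc ‖L (y - y')‖ = ‖(x - L y') - (x - L y)‖ := by rw [map_sub]; congr 1; abel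
      _ ≤ ‖x - L y'‖ + ‖x - L y‖ := norm_sub_le _ _
      _ < η / (2 * (M + 1)) + η / (2 * (M + 1)) := add_lt_add h2 h1
      _ = η / (M + 1) := by field_simp; norm_num
  rw [dist_eq_norm]
  rw [lt_div_iff₀ (by positivity)] at h4
  nlinarith [norm_nonneg (L (y - y'))]

include hM0 hM hP in
/-- A Bohl--Bohr--Kadets theorem: in the absence of `c₀`, the orbit of `x` is totally bounded once
all differences `x - T x` lie in the range of `P`. -/
theorem totallyBounded_orbit_of_sub_mem_range (hE : ¬ ContainsCZero E) {x : E}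
    (hx : ∀ T ∈ S, ∃ r ∈ P.range, (r : E) = x - T x) : TotallyBounded (orbit S x) := by
  refine totallyBounded_orbit_of_small hM0 hM hP hx ?_
  by_contra! hcon
  obtain ⟨δ, hδ, hcon⟩ := hcon
  have hinj : Function.Injective ((↑) : aap (S : Set (E →L[ℂ] E)) → E) := Subtype.val_injective
  refine hE (containsCZero_of_approx_translations (D := {v | v = 0 ∨ ∃ T ∈ S, v = x - T x})
    (C := ‖x‖ + M * ‖x‖) hδ (Or.inl rfl) ?_ fun J hJ ε hε => ?_)
  · rintro v (rfl | ⟨T, hT, rfl⟩)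
    · rw [norm_zero]; positivity
    · exact (norm_sub_le _ _).trans (add_le_add_right (T.le_of_opNorm_le (hM T hT) x) _)
  · obtain ⟨B, hB, hBJ, hBx⟩ := hcon (J.preimage (↑) hinj.injOn) (fun v hv => by
      rcases hJ (Finset.mem_preimage.1 hv) with h0 | ⟨T, hT, hvT⟩
      · rw [show v = 0 from hinj h0]
        exact zero_mem _
      · obtain ⟨r, hr, hrT⟩ := hx T hT
        rwa [hinj (hvT.trans hrT.symm)]) ε hε
    refine ⟨x - B x, hBx, fun v hv => ?_⟩
    rcases hJ hv with rfl | ⟨T, hT, rfl⟩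
    · exact ⟨x - B x, Or.inr ⟨B, hB, rfl⟩, by simpa using hε.le⟩
    -- `(x - B x) + v - (x - B T x) = v - B v` for `v = x - T x`, which is small by the choice of
    -- `B`.
    · refine ⟨x - (B * T) x, Or.inr ⟨B * T, S.mul_mem hB hT, rfl⟩, ?_⟩
      obtain ⟨r, -, hrT⟩ := hx T hT
      have := hBJ r (Finset.mem_preimage.2 (hrT ▸ hv))
      rw [hrT, map_sub] at this
      refine le_of_eq_of_le ?_ this.le
      rw [mul_apply_eq_comp]
      congr 1
      abel

end Restriction

end
end JdLG

theorem theorem3p4 {E : Type*} [NormedAddCommGroup E] [NormedSpace ℂ E] [CompleteSpace E]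
    (hE : ¬ JdLG.ContainsCZero E)
    (S : Subsemigroup (E →L[ℂ] E))
    (hne : (S : Set (E →L[ℂ] E)).Nonempty)
    (hbdd : ∃ M : ℝ, ∀ T ∈ S, ‖T‖ ≤ M)
    (hab : ∀ A ∈ S, ∀ B ∈ S, A * B = B * A) :
    -- the projection of the restriction of the semigroup to the space `E_aap` is well defined
    (∃! P : JdLG.aap (S : Set (E →L[ℂ] E)) →L[ℂ] JdLG.aap (S : Set (E →L[ℂ] E)),
      JdLG.IsJdLGProjection (JdLG.restrictOps (S : Set (E →L[ℂ] E)) (JdLG.aap S)) P) ∧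
    ∀ P : JdLG.aap (S : Set (E →L[ℂ] E)) →L[ℂ] JdLG.aap (S : Set (E →L[ℂ] E)),
      JdLG.IsJdLGProjection (JdLG.restrictOps (S : Set (E →L[ℂ] E)) (JdLG.aap S)) P →
      ∀ x : E,
        JdLG.RelCompact (JdLG.orbit S x) ↔
          -- the first condition puts every `(1 - T) x` into `E_aap`, where `P` is defined
          ∃ h : ∀ T ∈ S, JdLG.RelCompact (JdLG.orbit S ((1 - T) x)),
            JdLG.RelCompact {y : E | ∃ (T : E →L[ℂ] E) (hT : T ∈ S),
              y = ((1 - P) ⟨(1 - T) x, JdLG.mem_aap.2 (h T hT)⟩ : JdLG.aap (S : Set (E →L[ℂ] E)))} := by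
  obtain ⟨M, hM⟩ := hbdd
  obtain ⟨T₀, hT₀⟩ := hne
  have hM0 : 0 ≤ M := (norm_nonneg T₀).trans (hM T₀ hT₀)
  have hcomm := JdLG.aapOps_comm hab
  refine ⟨?_, fun P hP x => ⟨fun hx => ?_, fun ⟨h, hK⟩ => ?_⟩⟩
  · obtain ⟨P, hP⟩ := JdLG.exists_isJdLGProjection ⟨_, JdLG.restrictAap_mem hT₀⟩
      JdLG.aapOps_mul_mem hcomm hM0 (JdLG.aapOps_norm_le hM0 hM) (JdLG.relCompact_orbit_aapOps hM)
    exact ⟨P, hP, fun P' hP' => hP'.unique hcomm hP⟩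
  · have h : ∀ T ∈ S, JdLG.RelCompact (JdLG.orbit S ((1 - T) x)) := fun T hT =>
      (JdLG.aap (S : Set (E →L[ℂ] E))).sub_mem hx (JdLG.mapsTo_aap S hT hx)
    exact ⟨h, JdLG.relCompact_of_mem_aap hM hx h⟩
  · obtain ⟨y, hy⟩ := JdLG.exists_sub_mem_range hM hP hab h hK
    have h1 : x - y ∈ JdLG.aap (S : Set (E →L[ℂ] E)) := JdLG.relCompact_iff_totallyBounded.2
      (JdLG.totallyBounded_orbit_of_sub_mem_range hM0 hM hP hE hy)
    have h2 := (JdLG.aap (S : Set (E →L[ℂ] E))).add_mem h1 y.2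
    rwa [sub_add_cancel] at h2
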